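/- Let $K$ and $L_1,\dots,L_K$ be positive integers (the sizes of the components of a complete $K$-partite graph). For $\nu>0$ let $(X_t)_{t\ge 0}$ be the continuous-time Markov process on the star-shaped state space $\Omega=\{0\}\cup\{(k,l): 1\le k\le K,\ 1\le l\le L_k\}$ with right-continuous paths and transition rates $q(0,(k,1))=L_k\nu$, $q((k,l),(k,l+1))=(L_k-l)\nu$ for $1\le l\le L_k-1$, $q((k,1),0)=1$, $q((k,l),(k,l-1))=l$ for $2\le l\le L_k$, and no other transitions. Let $T_{(k_1,l_1),(k_2,l_2)}(\nu)=\inf\{t>0: X_t=(k_2,l_2)\}$ be the first-passage time of $(k_2,l_2)$ when $X_0=(k_1,l_1)$. Let $k_1\neq k_2$, $0<l_1\le L_{k_1}$, $0<l_2\le L_{k_2}$, and put $L_*=\max_{j\ne k_2}L_j$ and $K_*=\{k\neq k_2: L_k=L_*\}$. Then $\mathbb{E}\,T_{(k_1,l_1),(k_2,l_2)}(\nu)$ is finite for every $\nu>0$, and, as $\nu\to\infty$, \[ \mathbb{E}\,T_{(k_1,l_1),(k_2,l_2)}(\nu)\ \sim\ \left(\frac{\mathbf 1\{k_1\in K_*\}}{L_*}+\frac{|K_*|}{L_{k_2}}\right)\nu^{L_*-1},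 \] where $f(\nu)\sim g(\nu)$ means $\lim_{\nu\to\infty}f(\nu)/g(\nu)=1$. -/

import Mathlib

open Filter Topology MeasureTheory
open scoped NNReal ENNReal

noncomputable section

/-- The star-shaped state space: the centre `0` is `none`, and the state with `l` active nodes in
component `k`, `1 ≤ l ≤ L k`, is `some ⟨k, l⟩`. -/
abbrev StarState {K : ℕ} (L : Fin K → ℕ) : Type :=
  Option (Σ k : Fin K, {l : ℕ // l ∈ Finset.Icc 1 (L k)})

/-- The state `(k, l)`. -/
def StarState.mk {K : ℕ} {L : Fin K → ℕ} (k : Fin K) (l : ℕ) (hl : 0 < l ∧ l ≤ L k) :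
    StarState L :=
  some ⟨k, l, Finset.mem_Icc.2 hl⟩

/-- The transition rates `q(x, y)`, `x ≠ y`, of the activity process with activation rate `ν`
(with the value `0` on the diagonal). -/
def starRate {K : ℕ} (L : Fin K → ℕ) (ν : ℝ) : StarState L → StarState L → ℝ
  | none, none => 0
  | none, some ⟨k, l⟩ => if (l : ℕ) = 1 then (L k : ℝ) * ν else 0
  | some ⟨_, l⟩, none => if (l : ℕ) = 1 then 1 else 0
  | some ⟨k, l⟩, some ⟨k', l'⟩ =>
      if k = k' then
        if (l' : ℕ) = l + 1 then ((L k : ℝ) - (l : ℕ)) * ν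
        else if (l : ℕ) = l' + 1 then ((l : ℕ) : ℝ)
        else 0
      else 0

/-- The generator (Q-matrix) with given off-diagonal rates: every row sums to zero. -/
def generator {S : Type*} [Fintype S] [DecidableEq S] (q : S → S → ℝ) : Matrix S S ℝ :=
  Matrix.of fun x y => if x = y then -∑ z ∈ Finset.univ.erase x, q x z else q x y

/-- `X` is, under `P`, a continuous-time Markov process on the finite set `S` with transition
rates `q`, started in `x₀`: it has almost surely right-continuous paths (for the discrete topology
on `S`), and its finite-dimensional distributions are those given by the initial state `x₀` and the
transition semigroup `exp (t Q)`, where `Q` is the generator. -/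
structure IsMarkovProcess {S : Type*} [Fintype S] [DecidableEq S] (q : S → S → ℝ) (x₀ : S)
    {Ω : Type*} [MeasurableSpace Ω] (P : Measure Ω) (X : ℝ≥0 → Ω → S) : Prop where
  isProbabilityMeasure : IsProbabilityMeasure P
  measurableSet_eq : ∀ t x, MeasurableSet {ω | X t ω = x}
  right_continuous : ∀ᵐ ω ∂P, ∀ t, ∀ᶠ s in 𝓝[>] t, X s ω = X t ω
  finite_dim : ∀ (n : ℕ) (t : ℕ → ℝ≥0) (x : ℕ → S), t 0 = 0 → Monotone t →
    P.real {ω | ∀ i ≤ n, X (t i) ω = x i} =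
      (if x 0 = x₀ then 1 else 0) *
        ∏ i ∈ Finset.range n,
          NormedSpace.exp (((t (i + 1) : ℝ) - (t i : ℝ)) • generator q) (x i) (x (i + 1))

/-- The first-passage time `inf {t > 0 : X_t = y}`, equal to `∞` if `y` is never reached. -/
def passageTime {S Ω : Type*} (X : ℝ≥0 → Ω → S) (y : S) (ω : Ω) : ℝ≥0∞ :=
  ⨅ t ∈ {t : ℝ≥0 | 0 < t ∧ X t ω = y}, (t : ℝ≥0∞)

/-- `L_*`: the largest size of a component other than `k₂`. -/
def maxOtherSize {K : ℕ} (L : Fin K → ℕ) (k₂ : Fin K) : ℕ :=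
  (Finset.univ.erase k₂).sup L

/-- `K_*`: the components other than `k₂` of size `L_*`. -/
def maxOtherSet {K : ℕ} (L : Fin K → ℕ) (k₂ : Fin K) : Finset (Fin K) :=
  {k | k ≠ k₂ ∧ L k = maxOtherSize L k₂}

end

/-! The mean first-passage time of `y` is a nonnegative function `h` with `h y = 0` and `Q h = -1`
off `y`, where `Q` is the generator. The proof has three ingredients: any such `h` is the mean, an
explicit `h` exists on the star, and its growth in `ν` can be read off.

For the first (`IsMarkovProcess.lintegral_passageTime`), the process is observed on the dyadic grid
of mesh `δ`. Since `exp (δ Q) h - h = -δ + o(δ)` off `y`, each step before the hit lowers the mean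
of `h` by `δ` up to a small relative error, so the grid hitting time has mean close to `h x₀`.
Refining the grid makes grid hitting times decrease to the passage time, by right-continuity, and
dominated convergence passes to the limit.

For the second (`generator_mulVec_meanPassage`), a path on a star crosses its levels one at a time,
so `h` is a sum of mean one-level crossing times. First-step analysis gives a recursion for the
descents `D` towards the centre and one for the ascents `A` towards the target. The two meet at the
centre, where `L k₂ * ν * A 0 = 1 + ∑ L k * ν * D`, each `D` being the mean return time to `0` from
level 1 of a branch `k ≠ k₂`.

For the third (`tendsto_branchMean`), the descent from level 1 to `0` in a component of size `L`
takes about `ν ^ (L - 1) / L`. At order `ν ^ (L_* - 1)` only two crossings survive: leaving the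
starting component, if it has size `L_*`, and the first step from `0` into `k₂`, to which each
component of `K_*` contributes `1 / L k₂`. -/

noncomputable section

/-! ### Hitting times along dyadic time grids -/

section Skeleton

variable {S Ω : Type*}

/-- The first time at which the skeleton `X 0, X δ, X (2 δ), …` visits `y`. -/
def skeletonTime (X : ℝ≥0 → Ω → S) (y : S) (δ : ℝ≥0) (ω : Ω) : ℝ≥0∞ :=
  ⨅ n ∈ {n : ℕ | X (n * δ) ω = y}, (n : ℝ≥0∞) * δ

/-- The event that the skeleton has not visited `y` up to step `n`. -/
def skeletonAvoids (X : ℝ≥0 → Ω → S) (y : S) (δ : ℝ≥0) (n : ℕ) : Set Ω :=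
  {ω | ∀ i ≤ n, X (i * δ) ω ≠ y}

/-- Each step up to which `y` has been avoided adds `δ`, and both sides are infinite if `y` is never
met. Expectations thereby become sums of avoidance probabilities. -/
theorem skeletonTime_eq_tsum (X : ℝ≥0 → Ω → S) (y : S) {δ : ℝ≥0} (hδ : 0 < δ) (ω : Ω) :
    skeletonTime X y δ ω =
      ∑' n : ℕ, (skeletonAvoids X y δ n).indicator (fun _ => (δ : ℝ≥0∞)) ω := by
  classical
  by_cases h : ∃ n : ℕ, X (n * δ) ω = y
  · have hs := Nat.find_spec h
    have hmin : ∀ m : ℕ, m < Nat.find h → X (m * δ) ω ≠ y := fun m hm => Nat.find_min h hm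
    set N := Nat.find h
    have h1 : skeletonTime X y δ ω = (N : ℝ≥0∞) * δ := by
      apply le_antisymm
      · exact iInf₂_le (f := fun (n : ℕ) (_ : n ∈ {n : ℕ | X (n * δ) ω = y}) =>
          (n : ℝ≥0∞) * δ) N hs
      · refine le_iInf₂ fun n hn => ?_
        have : N ≤ n := by
          by_contra hlt
          exact hmin n (not_le.1 hlt) hn
        gcongr
    rw [h1, tsum_eq_sum (s := Finset.range N)]
    · rw [Finset.sum_congr rfl (g := fun _ => (δ : ℝ≥0∞))]
      · simp
      · intro n hn
        rw [Set.indicator_of_mem]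
        intro i hi
        exact hmin i (lt_of_le_of_lt hi (Finset.mem_range.1 hn))
    · intro n hn
      rw [Set.indicator_of_notMem]
      intro hmem
      exact hmem N (not_lt.1 fun hlt => hn (Finset.mem_range.2 hlt)) hs
  · push Not at h
    have h1 : skeletonTime X y δ ω = ⊤ := by
      simp [skeletonTime, h]
    have h2 : ∀ n : ℕ, (skeletonAvoids X y δ n).indicator (fun _ => (δ : ℝ≥0∞)) ω = δ :=
      fun n => Set.indicator_of_mem (show ω ∈ skeletonAvoids X y δ n from fun i _ => h i) _
    rw [h1, tsum_congr h2, ENNReal.tsum_const_eq_top_of_ne_zero]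
    exact_mod_cast hδ.ne'

/-- The grid includes time `0`, which the passage time excludes; hence the condition on the start.
-/
theorem passageTime_le_skeletonTime (X : ℝ≥0 → Ω → S) (y : S) {δ : ℝ≥0} (hδ : 0 < δ) {ω : Ω}
    (h0 : X 0 ω ≠ y) : passageTime X y ω ≤ skeletonTime X y δ ω := by
  refine le_iInf₂ fun n hn => ?_
  have hn' : X (n * δ) ω = y := hn
  have hpos : 0 < n := by
    rcases Nat.eq_zero_or_pos n with rfl | h
    · simp at hn'; exact absurd hn' h0
    · exact h
  have : (0 : ℝ≥0) < n * δ := by positivity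
  refine (iInf₂_le (f := fun (t : ℝ≥0) (_ : t ∈ {t : ℝ≥0 | 0 < t ∧ X t ω = y}) => (t : ℝ≥0∞))
    (n * δ) ⟨this, hn'⟩).trans ?_
  simp

/-- Dyadic grids are nested: the point `n` of one is the point `2 n` of the next. -/
theorem antitone_skeletonTime (X : ℝ≥0 → Ω → S) (y : S) (ω : Ω) :
    Antitone fun m : ℕ => skeletonTime X y ((2⁻¹ : ℝ≥0) ^ m) ω := by
  refine antitone_nat_of_succ_le fun m => le_iInf₂ fun n hn => ?_
  have key : ((2 * n : ℕ) : ℝ≥0) * (2⁻¹ : ℝ≥0) ^ (m + 1) = n * (2⁻¹ : ℝ≥0) ^ m := by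
    push_cast; rw [pow_succ]; field_simp
  have hn' : X (((2 * n : ℕ) : ℝ≥0) * (2⁻¹ : ℝ≥0) ^ (m + 1)) ω = y := by rw [key]; exact hn
  refine (iInf₂_le (f := fun (n : ℕ) (_ : n ∈ {n : ℕ | X (n * (2⁻¹ : ℝ≥0) ^ (m + 1)) ω = y}) =>
    (n : ℝ≥0∞) * ((2⁻¹ : ℝ≥0) ^ (m + 1) : ℝ≥0)) (2 * n) hn').trans ?_
  exact_mod_cast key.le

/-- After a visit to `y` at time `t`, right-continuity keeps the path in `y` on some `(t, u)`. A
grid of mesh below `min (u - t) ε` has a point there, within `ε` of `t`. -/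
theorem tendsto_skeletonTime (X : ℝ≥0 → Ω → S) (y : S) {ω : Ω} (h0 : X 0 ω ≠ y)
    (hrc : ∀ t, ∀ᶠ s in 𝓝[>] t, X s ω = X t ω) :
    Tendsto (fun m : ℕ => skeletonTime X y ((2⁻¹ : ℝ≥0) ^ m) ω) atTop
      (𝓝 (passageTime X y ω)) := by
  have hlim := tendsto_atTop_iInf (antitone_skeletonTime X y ω)
  convert hlim using 2
  apply le_antisymm
  · exact le_iInf fun m => passageTime_le_skeletonTime X y (by positivity) h0
  refine le_iInf₂ fun t ht => ?_
  have ht' : X t ω = y := ht.2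
  refine ENNReal.le_of_forall_pos_le_add fun ε hε _ => ?_
  obtain ⟨u, hu, hsub⟩ := (mem_nhdsGT_iff_exists_Ioo_subset' (show t < t + 1 by simp)).1 (hrc t)
  have hu' : t < u := hu
  set η : ℝ≥0 := min (u - t) ε with hη
  have hηpos : 0 < η := lt_min (tsub_pos_of_lt hu') hε
  obtain ⟨m, hm⟩ := exists_pow_lt_of_lt_one hηpos
    (show (2⁻¹ : ℝ≥0) < 1 from inv_lt_one_of_one_lt₀ one_lt_two)
  set δ : ℝ≥0 := 2⁻¹ ^ m with hδ
  have hδpos : 0 < δ := by positivity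
  set n : ℕ := ⌊t / δ⌋₊ + 1 with hn
  have h1 : t < n * δ := by
    have := Nat.lt_floor_add_one (t / δ)
    rw [div_lt_iff₀ hδpos] at this
    simpa [hn] using this
  have h2 : n * δ ≤ t + δ := by
    have := Nat.floor_le (show (0 : ℝ≥0) ≤ t / δ from zero_le)
    rw [le_div_iff₀ hδpos] at this
    rw [hn]; push_cast; rw [add_mul, one_mul]; gcongr
  have h3 : (n : ℝ≥0) * δ < u := by
    refine lt_of_le_of_lt h2 ?_
    calc t + δ < t + (u - t) := by
          gcongr
          exact lt_of_lt_of_le hm (min_le_left _ _)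
      _ = u := add_tsub_cancel_of_le hu'.le
  have hX : X (n * δ) ω = y := by
    have : X (n * δ) ω = X t ω := hsub ⟨h1, h3⟩
    rw [this, ht']
  refine (iInf_le _ m).trans ?_
  refine (iInf₂_le (f := fun (n : ℕ) (_ : n ∈ {n : ℕ | X (n * δ) ω = y}) =>
    (n : ℝ≥0∞) * δ) n hX).trans ?_
  have : (n : ℝ≥0) * δ ≤ t + ε := h2.trans (by gcongr; exact (hm.le.trans (min_le_right _ _)))
  exact_mod_cast this

end Skeleton

/-! ### Mean passage times from the hitting-time equations -/

section Markov

variable {S : Type*} [Fintype S] [DecidableEq S] {q : S → S → ℝ} {x₀ : S}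
  {Ω : Type*} [MeasurableSpace Ω] {P : Measure Ω} {X : ℝ≥0 → Ω → S}

theorem IsMarkovProcess.ae_zero_eq (hX : IsMarkovProcess q x₀ P X) : ∀ᵐ ω ∂P, X 0 ω = x₀ := by
  have := hX.isProbabilityMeasure
  have h := hX.finite_dim 0 (fun _ => 0) (fun _ => x₀) rfl monotone_const
  simp only [nonpos_iff_eq_zero, forall_eq, if_true, Finset.range_zero, Finset.prod_empty,
    mul_one] at h
  rw [ae_iff, ← Set.compl_ofPred, prob_compl_eq_zero_iff (hX.measurableSet_eq 0 x₀)]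
  rwa [measureReal_def, ENNReal.toReal_eq_one_iff] at h

theorem IsMarkovProcess.measurableSet_avoids_lt (hX : IsMarkovProcess q x₀ P X) (y : S) (δ : ℝ≥0)
    (n : ℕ) : MeasurableSet {ω | ∀ i < n, X (i * δ) ω ≠ y} := by
  simp only [Set.ofPred_forall]
  exact MeasurableSet.iInter fun i => MeasurableSet.iInter fun _ =>
    (hX.measurableSet_eq (i * δ) y).compl

theorem IsMarkovProcess.measurableSet_skeletonAvoids (hX : IsMarkovProcess q x₀ P X) (y : S)
    (δ : ℝ≥0) (n : ℕ) : MeasurableSet (skeletonAvoids X y δ n) := by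
  have := hX.measurableSet_avoids_lt y δ (n + 1)
  simpa only [Nat.lt_succ_iff, skeletonAvoids] using this

theorem IsMarkovProcess.measureReal_eq_sum (hX : IsMarkovProcess q x₀ P X) {A : Set Ω}
    (hA : MeasurableSet A) (t : ℝ≥0) :
    P.real A = ∑ z, P.real {ω | ω ∈ A ∧ X t ω = z} := by
  have := hX.isProbabilityMeasure
  rw [← measureReal_biUnion_finset]
  · congr 1
    ext ω
    simp
  · intro a _ b _ hab
    refine Set.disjoint_left.2 fun ω h1 h2 => hab ?_
    exact h1.2.symm.trans h2.2
  · intro z _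
    exact hA.inter (hX.measurableSet_eq t z)

/-- The one-step transition law of the `δ`-skeleton on cylinder sets that avoid `y` up to time `k`
and follow `x` from then on. -/
theorem IsMarkovProcess.cylinder_succ (hX : IsMarkovProcess q x₀ P X) (y : S) (δ : ℝ≥0) (n : ℕ) :
    ∀ k ≤ n, ∀ x : ℕ → S,
      P.real {ω | (∀ i < k, X (i * δ) ω ≠ y) ∧ ∀ i, k ≤ i → i ≤ n + 1 → X (i * δ) ω = x i} =
        P.real {ω | (∀ i < k, X (i * δ) ω ≠ y) ∧ ∀ i, k ≤ i → i ≤ n → X (i * δ) ω = x i} *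
          NormedSpace.exp ((δ : ℝ) • generator q) (x n) (x (n + 1)) := by
  have := hX.isProbabilityMeasure
  have hmeas : ∀ (k N : ℕ) (x : ℕ → S), MeasurableSet
      {ω | (∀ i < k, X (i * δ) ω ≠ y) ∧ ∀ i, k ≤ i → i ≤ N → X (i * δ) ω = x i} := by
    intro k N x
    refine (hX.measurableSet_avoids_lt y δ k).inter
      (s₂ := {ω | ∀ i, k ≤ i → i ≤ N → X (i * δ) ω = x i}) ?_
    simp only [Set.ofPred_forall]
    exact MeasurableSet.iInter fun i => MeasurableSet.iInter fun _ => MeasurableSet.iInter fun _ =>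
      hX.measurableSet_eq (i * δ) (x i)
  -- Splitting according to the position `z ≠ y` at step `k` trades an avoidance constraint for a
  -- prescribed value, which drives the induction on `k` down to `finite_dim`.
  have hsum : ∀ (k N : ℕ) (x : ℕ → S), k ≤ N → P.real
      {ω | (∀ i < k + 1, X (i * δ) ω ≠ y) ∧ ∀ i, k + 1 ≤ i → i ≤ N → X (i * δ) ω = x i} =
      ∑ z, if z = y then 0 else P.real {ω | (∀ i < k, X (i * δ) ω ≠ y) ∧
        ∀ i, k ≤ i → i ≤ N → X (i * δ) ω = Function.update x k z i} := by
    intro k N x hkN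
    rw [hX.measureReal_eq_sum (hmeas (k + 1) N x) (k * δ)]
    refine Finset.sum_congr rfl fun z _ => ?_
    split_ifs with hz
    · convert measureReal_empty (μ := P)
      refine Set.eq_empty_of_forall_notMem fun ω hω => ?_
      exact hω.1.1 k (Nat.lt_succ_self k) (hω.2.trans hz)
    · congr 1
      ext ω
      constructor
      · rintro ⟨⟨h1, h2⟩, h3⟩
        refine ⟨fun i hi => h1 i (by lia), fun i hi hiN => ?_⟩
        rcases hi.eq_or_lt with rfl | hlt
        · simpa using h3
        · rw [Function.update_of_ne (by lia)]
          exact h2 i hlt hiN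
      · rintro ⟨h1, h2⟩
        have h3 : X (k * δ) ω = z := by simpa using h2 k le_rfl hkN
        refine ⟨⟨fun i hi => ?_, fun i hi hiN => ?_⟩, h3⟩
        · rcases (Nat.lt_succ_iff.1 hi).eq_or_lt with rfl | hlt
          · rw [h3]; exact hz
          · exact h1 i hlt
        · have := h2 i (by lia) hiN
          rwa [Function.update_of_ne (by lia)] at this
  intro k
  induction k with
  | zero =>
    intro _ x
    have hmono : Monotone fun i : ℕ => (i : ℝ≥0) * δ := fun a b hab => by
      dsimp only; gcongr
    have h1 := hX.finite_dim (n + 1) (fun i => i * δ) x (by simp) hmono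
    have h2 := hX.finite_dim n (fun i => i * δ) x (by simp) hmono
    rw [Finset.prod_range_succ, ← mul_assoc, ← h2] at h1
    simp only [not_lt_zero, IsEmpty.forall_iff, implies_true, zero_le, true_and, forall_const]
    rw [h1]
    rw [show (((n + 1 : ℕ) * δ : ℝ≥0) : ℝ) - ((n * δ : ℝ≥0) : ℝ) = (δ : ℝ) by push_cast; ring]
  | succ k ih =>
    intro hk x
    rw [hsum k (n + 1) x (by lia), hsum k n x (by lia), Finset.sum_mul]
    refine Finset.sum_congr rfl fun z _ => ?_
    split_ifs with hz
    · simp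
    · rw [ih (by lia), Function.update_of_ne (by lia), Function.update_of_ne (by lia)]

/-- The probability that the skeleton is in `z` at step `n` and has not visited `y` before. -/
def avoidMass (P : Measure Ω) (X : ℝ≥0 → Ω → S) (y : S) (δ : ℝ≥0) (n : ℕ) (z : S) : ℝ :=
  P.real {ω | (∀ i < n, X (i * δ) ω ≠ y) ∧ X (n * δ) ω = z}

theorem IsMarkovProcess.avoidMass_zero (hX : IsMarkovProcess q x₀ P X) (y : S) (δ : ℝ≥0) (z : S) :
    avoidMass P X y δ 0 z = if z = x₀ then 1 else 0 := by
  have := hX.isProbabilityMeasure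
  have h := hX.finite_dim 0 (fun _ => 0) (fun _ => z) rfl monotone_const
  simpa [avoidMass] using h

theorem IsMarkovProcess.avoidMass_succ (hX : IsMarkovProcess q x₀ P X) (y : S) (δ : ℝ≥0) (n : ℕ)
    (w : S) :
    avoidMass P X y δ (n + 1) w = ∑ z ∈ Finset.univ.erase y,
      avoidMass P X y δ n z * NormedSpace.exp ((δ : ℝ) • generator q) z w := by
  have := hX.isProbabilityMeasure
  have hA : MeasurableSet {ω | (∀ i < n + 1, X (i * δ) ω ≠ y) ∧ X ((n + 1 : ℕ) * δ) ω = w} :=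
    (hX.measurableSet_avoids_lt y δ (n + 1)).inter (hX.measurableSet_eq _ w)
  rw [avoidMass, hX.measureReal_eq_sum hA (n * δ), ← Finset.sum_erase_add _ _ (Finset.mem_univ y)]
  rw [show {ω | ω ∈ {ω | (∀ i < n + 1, X (i * δ) ω ≠ y) ∧ X ((n + 1 : ℕ) * δ) ω = w} ∧
      X (n * δ) ω = y} = ∅ from Set.eq_empty_of_forall_notMem fun ω hω =>
        hω.1.1 n (Nat.lt_succ_self n) hω.2, measureReal_empty, add_zero]
  refine Finset.sum_congr rfl fun z hz => ?_
  have hzy : z ≠ y := Finset.ne_of_mem_erase hz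
  have h := hX.cylinder_succ y δ n n le_rfl (fun i => if i = n then z else w)
  simp only [if_true, Nat.succ_ne_self, if_false] at h
  rw [avoidMass]
  convert h using 3
  · ext ω
    constructor
    · rintro ⟨⟨h1, h2⟩, h3⟩
      refine ⟨fun i hi => h1 i (by lia), fun i hi hin => ?_⟩
      obtain rfl | rfl : i = n ∨ i = n + 1 := by lia
      · simpa using h3
      · simpa using h2
    · rintro ⟨h1, h2⟩
      have h3 : X (n * δ) ω = z := by simpa using h2 n le_rfl (by lia)
      refine ⟨⟨fun i hi => ?_, by simpa using h2 (n + 1) (by lia) le_rfl⟩, h3⟩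
      rcases (Nat.lt_succ_iff.1 hi).eq_or_lt with rfl | hlt
      · rw [h3]; exact hzy
      · exact h1 i hlt
  · ext ω
    refine and_congr_right fun _ => ⟨fun h i hi hin => ?_, fun h => ?_⟩
    · obtain rfl : i = n := by lia
      simpa using h
    · simpa using h n le_rfl le_rfl

/-- Moving the transition matrix from the mass to the test function brings in `exp (δ Q) h`. -/
theorem IsMarkovProcess.sum_avoidMass_succ_mul (hX : IsMarkovProcess q x₀ P X) (y : S) (δ : ℝ≥0)
    (n : ℕ) (g : S → ℝ) :
    ∑ w, avoidMass P X y δ (n + 1) w * g w = ∑ z ∈ Finset.univ.erase y,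
      avoidMass P X y δ n z * (NormedSpace.exp ((δ : ℝ) • generator q)).mulVec g z := by
  simp only [hX.avoidMass_succ, Finset.sum_mul, Matrix.mulVec, dotProduct, Finset.mul_sum]
  rw [Finset.sum_comm]
  simp only [mul_assoc]

theorem IsMarkovProcess.measureReal_skeletonAvoids (hX : IsMarkovProcess q x₀ P X) (y : S)
    (δ : ℝ≥0) (n : ℕ) :
    P.real (skeletonAvoids X y δ n) = ∑ z ∈ Finset.univ.erase y, avoidMass P X y δ n z := by
  have := hX.isProbabilityMeasure
  rw [hX.measureReal_eq_sum (hX.measurableSet_skeletonAvoids y δ n) (n * δ),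
    ← Finset.sum_erase_add _ _ (Finset.mem_univ y)]
  rw [show {ω | ω ∈ skeletonAvoids X y δ n ∧ X (n * δ) ω = y} = ∅ from
    Set.eq_empty_of_forall_notMem fun ω hω => hω.1 n le_rfl hω.2, measureReal_empty, add_zero]
  refine Finset.sum_congr rfl fun z hz => ?_
  have hzy : z ≠ y := Finset.ne_of_mem_erase hz
  rw [avoidMass]
  congr 1
  ext ω
  refine and_congr_left fun hω => ⟨fun h i hi => h i hi.le, fun h i hi => ?_⟩
  rcases hi.eq_or_lt with rfl | hlt
  · rw [hω]; exact hzy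
  · exact h i hlt

/-- If `h` approximately solves the hitting-time equations of the `δ`-skeleton, then it is
approximately the mean hitting time of the skeleton. -/
theorem IsMarkovProcess.lintegral_skeletonTime (hX : IsMarkovProcess q x₀ P X) {y : S} {δ : ℝ≥0}
    (hδ : 0 < δ) {ε : ℝ} (hε : ε < 1) {h : S → ℝ} (h0 : ∀ x, 0 ≤ h x) (hy : h y = 0)
    (hh : ∀ x ≠ y, |(NormedSpace.exp ((δ : ℝ) • generator q)).mulVec h x - h x + δ| ≤ ε * δ) :
    ∃ s : ℝ, ∫⁻ ω, skeletonTime X y δ ω ∂P = ENNReal.ofReal s ∧ 0 ≤ s ∧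
      (1 - ε) * s ≤ h x₀ ∧ h x₀ ≤ (1 + ε) * s := by
  have := hX.isProbabilityMeasure
  have hδ' : (0 : ℝ) < δ := by exact_mod_cast hδ
  set u : ℕ → ℝ := fun n => P.real (skeletonAvoids X y δ n) with hu
  set a : ℕ → ℝ := fun n => ∑ z, avoidMass P X y δ n z * h z with ha
  have hm0 : ∀ n z, 0 ≤ avoidMass P X y δ n z := fun n z => measureReal_nonneg
  have hu0 : ∀ n, 0 ≤ u n := fun n => measureReal_nonneg
  have ha0 : ∀ n, 0 ≤ a n := fun n => Finset.sum_nonneg fun z _ => mul_nonneg (hm0 n z) (h0 z)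
  have ha_erase : ∀ n, a n = ∑ z ∈ Finset.univ.erase y, avoidMass P X y δ n z * h z := by
    intro n
    simp only [ha]
    rw [← Finset.sum_erase_add _ _ (Finset.mem_univ y), hy, mul_zero, add_zero]
  have haz : a 0 = h x₀ := by
    simp [ha, hX.avoidMass_zero]
  -- `a n` is the mean of `h` at step `n` over the paths that have avoided `y` earlier. Only the
  -- surviving mass `u n` moves on, and it loses `δ` per unit up to `ε * δ`.
  have hstep : ∀ n, |a (n + 1) - a n + δ * u n| ≤ ε * (δ * u n) := by
    intro n
    rw [show a (n + 1) = _ from hX.sum_avoidMass_succ_mul y δ n h, ha_erase n,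
      show u n = _ from hX.measureReal_skeletonAvoids y δ n, ← Finset.sum_sub_distrib,
      Finset.mul_sum, ← Finset.sum_add_distrib, Finset.mul_sum]
    refine (Finset.abs_sum_le_sum_abs _ _).trans (Finset.sum_le_sum fun z hz => ?_)
    rw [show ∀ m p b : ℝ, m * p - m * b + δ * m = m * (p - b + δ) by intros; ring, abs_mul,
      abs_of_nonneg (hm0 n z)]
    calc _ ≤ avoidMass P X y δ n z * (ε * δ) :=
          mul_le_mul_of_nonneg_left (hh z (Finset.ne_of_mem_erase hz)) (hm0 n z)
      _ = _ := by ring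
  have hup : ∀ N, (1 - ε) * ∑ n ∈ Finset.range N, δ * u n ≤ h x₀ - a N := by
    intro N
    induction N with
    | zero => simp [haz]
    | succ N ih =>
      rw [Finset.sum_range_succ, mul_add]
      linarith [(abs_le.1 (hstep N)).2]
  have hlow : ∀ N, h x₀ - a N ≤ (1 + ε) * ∑ n ∈ Finset.range N, δ * u n := by
    intro N
    induction N with
    | zero => simp [haz]
    | succ N ih =>
      rw [Finset.sum_range_succ, mul_add]
      linarith [(abs_le.1 (hstep N)).1]
  have hδu0 : ∀ n, 0 ≤ δ * u n := fun n => mul_nonneg hδ'.le (hu0 n)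
  -- Since `ε < 1` and `a N ≥ 0`, the telescoped upper bound controls the partial sums; in
  -- particular the mean hitting time is finite.
  have hsummable : Summable fun n => δ * u n := by
    refine summable_of_sum_range_le (c := h x₀ / (1 - ε)) hδu0 fun N => ?_
    rw [le_div_iff₀ (by linarith), mul_comm]
    linarith [hup N, ha0 N]
  have hlim := hsummable.hasSum.tendsto_sum_nat
  have hu_lim : Tendsto u atTop (𝓝 0) := by
    have := hsummable.tendsto_atTop_zero.const_mul (δ : ℝ)⁻¹
    simpa [hδ'.ne'] using this
  have ha_lim : Tendsto a atTop (𝓝 0) := by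
    have hle : ∀ n, a n ≤ (∑ z, h z) * u n := by
      intro n
      rw [ha_erase, show u n = _ from hX.measureReal_skeletonAvoids y δ n, Finset.mul_sum]
      refine Finset.sum_le_sum fun z _ => ?_
      rw [mul_comm]
      exact mul_le_mul_of_nonneg_right
        (Finset.single_le_sum (fun x _ => h0 x) (Finset.mem_univ z)) (hm0 n z)
    refine squeeze_zero ha0 hle ?_
    simpa using hu_lim.const_mul (∑ z, h z)
  refine ⟨∑' n, δ * u n, ?_, tsum_nonneg hδu0, ?_, ?_⟩
  · simp_rw [skeletonTime_eq_tsum X y hδ]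
    rw [lintegral_tsum fun n =>
      (measurable_const.indicator (hX.measurableSet_skeletonAvoids y δ n)).aemeasurable,
      ENNReal.ofReal_tsum_of_nonneg hδu0 hsummable]
    refine tsum_congr fun n => ?_
    rw [lintegral_indicator_const (hX.measurableSet_skeletonAvoids y δ n),
      ENNReal.ofReal_mul hδ'.le, ofReal_measureReal, ENNReal.ofReal_coe_nnreal]
  · have h1 := hlim.const_mul (1 - ε)
    refine le_of_tendsto h1 (Eventually.of_forall fun N => ?_)
    linarith [hup N, ha0 N]
  · have h1 := (hlim.const_mul (1 + ε)).add ha_lim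
    rw [add_zero] at h1
    refine ge_of_tendsto h1 (Eventually.of_forall fun N => ?_)
    linarith [hlow N]

section Derivative

attribute [local instance] Matrix.linftyOpNormedRing Matrix.linftyOpNormedAlgebra

/-- This is the derivative of `exp (t A)` at `0`, uniform in `x` because `S` is finite. The matrix
norm is only auxiliary. -/
theorem Matrix.eventually_abs_exp_smul_mulVec_le (A : Matrix S S ℝ) (h : S → ℝ) {ε : ℝ}
    (hε : 0 < ε) :
    ∀ᶠ t : ℝ in 𝓝 0, ∀ x,
      |(NormedSpace.exp (t • A)).mulVec h x - h x - t * A.mulVec h x| ≤ ε * |t| := by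
  have hd : HasDerivAt (fun t : ℝ => NormedSpace.exp (t • A)) A 0 := by
    have := hasDerivAt_exp_smul_const (𝕂 := ℝ) A (0 : ℝ)
    rw [zero_smul, NormedSpace.exp_zero, one_mul] at this
    exact this
  rw [eventually_all]
  intro x
  have hx : HasDerivAt (fun t : ℝ => (NormedSpace.exp (t • A)).mulVec h x) (A.mulVec h x) 0 := by
    let φ : Matrix S S ℝ →ₗ[ℝ] ℝ :=
      { toFun := fun M => M.mulVec h x
        map_add' := fun M N => by simp [Matrix.add_mulVec]
        map_smul' := fun c M => by simp [Matrix.smul_mulVec] }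
    exact (LinearMap.toContinuousLinearMap φ).hasFDerivAt.comp_hasDerivAt (0 : ℝ) hd
  have := hx.isLittleO.def hε
  simpa [Real.norm_eq_abs] using this

end Derivative

/-- The mean first-passage time is given by any nonnegative solution of the hitting-time
equations. -/
theorem IsMarkovProcess.lintegral_passageTime (hX : IsMarkovProcess q x₀ P X) {y : S}
    (hxy : x₀ ≠ y) {h : S → ℝ} (h0 : ∀ x, 0 ≤ h x) (hy : h y = 0)
    (hh : ∀ x ≠ y, (generator q).mulVec h x = -1) :
    ∫⁻ ω, passageTime X y ω ∂P = ENNReal.ofReal (h x₀) := by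
  have := hX.isProbabilityMeasure
  have hpos : ∀ m : ℕ, (0 : ℝ≥0) < 2⁻¹ ^ m := fun m => by positivity
  have hδ_lim : Tendsto (fun m : ℕ => (((2⁻¹ : ℝ≥0) ^ m : ℝ≥0) : ℝ)) atTop (𝓝 0) := by
    push_cast
    exact tendsto_pow_atTop_nhds_zero_of_lt_one (by norm_num) (by norm_num)
  have hbounds : ∀ ε : ℝ, 0 < ε → ε < 1 → ∀ᶠ m : ℕ in atTop, ∃ s : ℝ,
      ∫⁻ ω, skeletonTime X y (2⁻¹ ^ m) ω ∂P = ENNReal.ofReal s ∧ 0 ≤ s ∧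
      (1 - ε) * s ≤ h x₀ ∧ h x₀ ≤ (1 + ε) * s := by
    intro ε hε hε1
    filter_upwards [hδ_lim.eventually
      (Matrix.eventually_abs_exp_smul_mulVec_le (generator q) h hε)] with m hm
    refine hX.lintegral_skeletonTime (hpos m) hε1 h0 hy fun x hx => ?_
    have := hm x
    rw [hh x hx, abs_of_nonneg (NNReal.coe_nonneg (2⁻¹ ^ m))] at this
    simpa using this
  have hmeas : ∀ m : ℕ, Measurable fun ω => skeletonTime X y (2⁻¹ ^ m) ω := by
    intro m
    simp_rw [skeletonTime_eq_tsum X y (hpos m)]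
    exact Measurable.tsum fun n =>
      measurable_const.indicator (hX.measurableSet_skeletonAvoids y _ n)
  -- One grid with finite mean hitting time dominates all finer ones.
  obtain ⟨m₀, hm₀⟩ := (hbounds (1 / 2) (by norm_num) (by norm_num)).exists
  have hlim : Tendsto (fun m : ℕ => ∫⁻ ω, skeletonTime X y (2⁻¹ ^ m) ω ∂P) atTop
      (𝓝 (∫⁻ ω, passageTime X y ω ∂P)) := by
    refine tendsto_lintegral_filter_of_dominated_convergence (skeletonTime X y (2⁻¹ ^ m₀))
      (Eventually.of_forall hmeas) ?_ ?_ ?_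
    · filter_upwards [eventually_ge_atTop m₀] with m hm
      exact Eventually.of_forall fun ω => antitone_skeletonTime X y ω hm
    · obtain ⟨s, hs, -⟩ := hm₀
      rw [hs]
      exact ENNReal.ofReal_ne_top
    · filter_upwards [hX.right_continuous, hX.ae_zero_eq] with ω hrc hω0
      exact tendsto_skeletonTime X y (by rw [hω0]; exact hxy) hrc
  refine tendsto_nhds_unique hlim ?_
  set f : ℕ → ℝ := fun m => (∫⁻ ω, skeletonTime X y (2⁻¹ ^ m) ω ∂P).toReal with hf
  have hf_lim : Tendsto f atTop (𝓝 (h x₀)) := by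
    refine Metric.tendsto_nhds.2 fun e he => ?_
    have hh0 := h0 x₀
    -- With `η ≤ 1 / 2` one gets `s ≤ 2 * h x₀`, so the error `η * s` is below `e`; the `+ 1` guards
    -- against `h x₀ = 0`.
    have hη : 0 < min (1 / 2) (e / (4 * (h x₀ + 1))) := by positivity
    filter_upwards [hbounds _ hη (lt_of_le_of_lt (min_le_left _ _) (by norm_num))] with m hm
    obtain ⟨s, hs, hs0, h1, h2⟩ := hm
    have hfs : f m = s := by rw [hf]; dsimp only; rw [hs, ENNReal.toReal_ofReal hs0]
    set η := min (1 / 2) (e / (4 * (h x₀ + 1)))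
    have hη1 : η ≤ 1 / 2 := min_le_left _ _
    have hη2 : η * (4 * (h x₀ + 1)) ≤ e := by
      rw [← le_div_iff₀ (by positivity)]
      exact min_le_right _ _
    have hs2 : s ≤ 2 * h x₀ := by nlinarith
    have hηs : η * s < e := by nlinarith
    rw [hfs, Real.dist_eq, abs_lt]
    constructor <;> linarith
  refine (ENNReal.tendsto_ofReal hf_lim).congr' ?_
  filter_upwards [hbounds (1 / 2) (by norm_num) (by norm_num)] with m hm
  obtain ⟨s, hs, hs0, -⟩ := hm
  rw [hf]
  dsimp only
  rw [hs, ENNReal.toReal_ofReal hs0]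

end Markov

/-! ### The generator of the star process -/

theorem generator_mulVec {S : Type*} [Fintype S] [DecidableEq S] (q : S → S → ℝ) (h : S → ℝ)
    (x : S) : (generator q).mulVec h x = ∑ z, q x z * (h z - h x) := by
  rw [Matrix.mulVec, dotProduct, ← Finset.sum_erase_add _ _ (Finset.mem_univ x),
    ← Finset.sum_erase_add (a := x) _ (fun z => q x z * (h z - h x)) (Finset.mem_univ x)]
  have hdiag : generator q x x = -∑ z ∈ Finset.univ.erase x, q x z := by
    rw [generator, Matrix.of_apply, if_pos rfl]
  have hoff : ∀ z ∈ Finset.univ.erase x, generator q x z * h z = q x z * h z := fun z hz => by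
    rw [generator, Matrix.of_apply, if_neg (Finset.ne_of_mem_erase hz).symm]
  rw [Finset.sum_congr rfl hoff, hdiag]
  simp only [mul_sub, Finset.sum_sub_distrib, ← Finset.sum_mul]
  ring

section StarGenerator

variable {K : ℕ} (L : Fin K → ℕ)

/-- The function on the star with value `c` at the centre and `f k l` at `(k, l)`. -/
def starFun (c : ℝ) (f : Fin K → ℕ → ℝ) : StarState L → ℝ
  | none => c
  | some ⟨k, l⟩ => f k l

theorem sum_starState (g : StarState L → ℝ) (g' : Fin K → ℕ → ℝ)
    (hg : ∀ k l, g (some ⟨k, l⟩) = g' k l) :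
    ∑ z, g z = g none + ∑ k, ∑ l ∈ Finset.Icc 1 (L k), g' k l := by
  rw [Fintype.sum_option, Fintype.sum_sigma]
  congr 1
  refine Finset.sum_congr rfl fun k _ => ?_
  exact (Finset.sum_congr rfl fun l _ => hg k l).trans (Finset.sum_coe_sort _ (g' k))

theorem generator_starRate_mulVec_none (ν c : ℝ) (f : Fin K → ℕ → ℝ) :
    (generator (starRate L ν)).mulVec (starFun L c f) none =
      ∑ k, (L k : ℝ) * ν * (f k 1 - c) := by
  rw [generator_mulVec, sum_starState L _
    (fun k l => if l = 1 then (L k : ℝ) * ν * (f k 1 - c) else 0)]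
  · simp only [starRate, zero_mul, zero_add, Finset.sum_ite_eq']
    refine Finset.sum_congr rfl fun k _ => ?_
    rcases Nat.eq_zero_or_pos (L k) with h | h
    · simp [h]
    · simp [Finset.mem_Icc, Nat.succ_le_of_lt h]
  · rintro k ⟨l, hl⟩
    simp only [starRate, starFun]
    split_ifs with h
    · rw [h]
    · simp

/-- The condition `f k 0 = c` makes the centre level `0` of every branch, so level 1 needs no
separate formula. At the top level the undefined neighbour carries the rate `L k - l = 0`. -/
theorem generator_starRate_mulVec_some (ν : ℝ) {c : ℝ} {f : Fin K → ℕ → ℝ}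
    (k : Fin K) (hf : f k 0 = c) (l : {l : ℕ // l ∈ Finset.Icc 1 (L k)}) :
    (generator (starRate L ν)).mulVec (starFun L c f) (some ⟨k, l⟩) =
      ((L k : ℝ) - (l : ℕ)) * ν * (f k (l + 1) - f k l) +
        ((l : ℕ) : ℝ) * (f k (l - 1) - f k l) := by
  obtain ⟨l, hl⟩ := l
  obtain ⟨hl1, hl2⟩ := Finset.mem_Icc.1 hl
  rw [generator_mulVec, sum_starState L _
    (fun k' l' => if k = k' then
      (if l' = l + 1 then ((L k : ℝ) - l) * ν * (f k (l + 1) - f k l) else 0) +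
      (if l' = l - 1 then (l : ℝ) * (f k (l - 1) - f k l) else 0) else 0)]
  · simp only [starRate, starFun, Finset.sum_ite_irrel, Finset.sum_const_zero,
      Finset.sum_ite_eq, Finset.mem_univ, if_true, Finset.sum_add_distrib, Finset.sum_ite_eq']
    have h1 : (if l + 1 ∈ Finset.Icc 1 (L k) then ((L k : ℝ) - l) * ν * (f k (l + 1) - f k l)
        else 0) = ((L k : ℝ) - l) * ν * (f k (l + 1) - f k l) := by
      split_ifs with h
      · rfl
      · have : l = L k := by
          rw [Finset.mem_Icc] at h; lia
        rw [this]; ring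
    rw [h1]
    rcases hl1.eq_or_lt with rfl | hlt
    · simp [hf]; ring
    · rw [if_neg (by lia), if_pos (Finset.mem_Icc.2 ⟨by lia, by lia⟩)]
      ring
  · rintro k' ⟨l', hl'⟩
    have hl1' := (Finset.mem_Icc.1 hl').1
    simp only [starRate, starFun]
    by_cases hk : k = k'
    · subst hk
      simp only [if_true]
      split_ifs with h1 h2 h3 h4 <;> first | lia | skip
      · rw [h1]; ring
      · rw [h4]; ring
      · simp
    · simp [hk]

end StarGenerator

/-! ### Mean crossing times of a single level -/

/-- `descentTime ν L n` is the mean time to go from level `L - n` to level `L - n - 1` in a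
component of size `L`. -/
def descentTime (ν : ℝ) (L : ℕ) : ℕ → ℝ
  | 0 => 1 / L
  | n + 1 => (1 + (n + 1) * ν * descentTime ν L n) / ((L : ℝ) - (n + 1))

/-- `ascentTime ν L a l` is the mean time to go from level `l` to level `l + 1` in a component of
size `L`, where `a` is the product of that time and the rate `L ν` for `l = 0`. -/
def ascentTime (ν : ℝ) (L : ℕ) (a : ℝ) : ℕ → ℝ
  | 0 => a / (L * ν)
  | l + 1 => (1 + (l + 1) * ascentTime ν L a l) / (((L : ℝ) - (l + 1)) * ν)

/-- The truncated bound `n ≤ L - 1` admits `L = 0`, where the value is `1 / 0 = 0`: components other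
than `k₁` and `k₂` may be empty here. -/
theorem descentTime_nonneg {ν : ℝ} (hν : 0 < ν) (L : ℕ) :
    ∀ n, n ≤ L - 1 → 0 ≤ descentTime ν L n
  | 0, _ => by simp [descentTime]
  | n + 1, hn => by
    have ih := descentTime_nonneg hν L n (by lia)
    have : ((n + 1 : ℕ) : ℝ) ≤ L := by exact_mod_cast (by lia : n + 1 ≤ L)
    push_cast at this
    rw [descentTime]
    exact div_nonneg (by positivity) (by linarith)

theorem ascentTime_nonneg {ν a : ℝ} (hν : 0 < ν) (ha : 0 ≤ a) (L : ℕ) :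
    ∀ l, l < L → 0 ≤ ascentTime ν L a l
  | 0, _ => by rw [ascentTime]; positivity
  | l + 1, hl => by
    have ih := ascentTime_nonneg hν ha L l (by lia)
    have : ((l + 1 : ℕ) : ℝ) ≤ L := by exact_mod_cast hl.le
    push_cast at this
    rw [ascentTime]
    exact div_nonneg (by positivity) (mul_nonneg (by linarith) hν.le)

/-- First-step analysis at level `l`: a move up must be undone before the descent. For `l = L` the
upward rate vanishes, so the truncated index on the right is harmless. -/
theorem mul_descentTime (ν : ℝ) {L l : ℕ} (hl : 0 < l) (hlL : l ≤ L) :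
    (l : ℝ) * descentTime ν L (L - l) =
      1 + ((L : ℝ) - l) * ν * descentTime ν L (L - (l + 1)) := by
  have hl' : (l : ℝ) ≠ 0 := by exact_mod_cast hl.ne'
  obtain ⟨n, rfl⟩ := Nat.exists_eq_add_of_le hlL
  cases n with
  | zero => simp [descentTime, hl']
  | succ n =>
    rw [show l + (n + 1) - l = n + 1 by lia, show l + (n + 1) - (l + 1) = n by lia, descentTime]
    push_cast
    rw [show (l : ℝ) + (n + 1) - (n + 1) = l by ring, mul_div_cancel₀ _ hl']
    ring

theorem mul_ascentTime_zero {ν : ℝ} (hν : 0 < ν) {L : ℕ} (hL : 0 < L) (a : ℝ) :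
    (L : ℝ) * ν * ascentTime ν L a 0 = a := by
  have : (L : ℝ) ≠ 0 := by exact_mod_cast hL.ne'
  rw [ascentTime]
  field_simp

theorem mul_ascentTime_succ {ν : ℝ} (hν : 0 < ν) {L l : ℕ} (hl : l + 1 < L) (a : ℝ) :
    ((L : ℝ) - (l + 1)) * ν * ascentTime ν L a (l + 1) = 1 + (l + 1) * ascentTime ν L a l := by
  have : ((l + 1 : ℕ) : ℝ) < L := by exact_mod_cast hl
  push_cast at this
  have h2 : (L : ℝ) - (l + 1) ≠ 0 := by linarith
  rw [ascentTime, mul_div_cancel₀]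
  exact mul_ne_zero h2 hν.ne'

/-! ### The explicit solution of the hitting-time equations -/

section MeanPassage

variable {K : ℕ} (L : Fin K → ℕ) (k₂ : Fin K) (l₂ : ℕ) (ν : ℝ)

/-- The mean passage time from `0` to `(k₂, 1)`, times the rate `L k₂ * ν` of that transition. -/
def excursionWeight : ℝ :=
  1 + ∑ k ∈ Finset.univ.erase k₂, (L k : ℝ) * ν * descentTime ν (L k) (L k - 1)

/-- The mean passage time from `0` to `(k₂, l₂)`. -/
def centreMean : ℝ :=
  ∑ j ∈ Finset.Ico 0 l₂, ascentTime ν (L k₂) (excursionWeight L k₂ ν) j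

/-- The mean passage time from `(k, l)` to `(k₂, l₂)`. -/
def branchMean (k : Fin K) (l : ℕ) : ℝ :=
  if k = k₂ then
    ∑ j ∈ Finset.Ico l l₂, ascentTime ν (L k₂) (excursionWeight L k₂ ν) j +
      ∑ j ∈ Finset.Ico l₂ l, descentTime ν (L k₂) (L k₂ - (j + 1))
  else
    centreMean L k₂ l₂ ν + ∑ j ∈ Finset.Ico 0 l, descentTime ν (L k) (L k - (j + 1))

variable {L k₂ l₂ ν}

theorem excursionWeight_nonneg (hν : 0 < ν) : 0 ≤ excursionWeight L k₂ ν :=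
  add_nonneg zero_le_one <| Finset.sum_nonneg fun k _ =>
    mul_nonneg (by positivity) (descentTime_nonneg hν _ _ le_rfl)

theorem centreMean_nonneg (hν : 0 < ν) (hl : l₂ ≤ L k₂) : 0 ≤ centreMean L k₂ l₂ ν :=
  Finset.sum_nonneg fun _ hj => ascentTime_nonneg hν (excursionWeight_nonneg hν) _ _
    (by have := Finset.mem_Ico.1 hj; lia)

theorem branchMean_nonneg (hν : 0 < ν) (hl : l₂ ≤ L k₂) (k : Fin K) (l : ℕ) :
    0 ≤ branchMean L k₂ l₂ ν k l := by
  rw [branchMean]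
  split_ifs
  · refine add_nonneg (Finset.sum_nonneg fun _ hj => ?_) (Finset.sum_nonneg fun _ hj => ?_)
    · exact ascentTime_nonneg hν (excursionWeight_nonneg hν) _ _
        (by have := Finset.mem_Ico.1 hj; lia)
    · exact descentTime_nonneg hν _ _ (by lia)
  · exact add_nonneg (centreMean_nonneg hν hl)
      (Finset.sum_nonneg fun _ _ => descentTime_nonneg hν _ _ (by lia))

theorem branchMean_zero (k : Fin K) : branchMean L k₂ l₂ ν k 0 = centreMean L k₂ l₂ ν := by
  rw [branchMean]
  split_ifs <;> simp [centreMean]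

theorem branchMean_succ_of_ne {k : Fin K} (hk : k ≠ k₂) (l : ℕ) :
    branchMean L k₂ l₂ ν k (l + 1) - branchMean L k₂ l₂ ν k l =
      descentTime ν (L k) (L k - (l + 1)) := by
  rw [branchMean, branchMean, if_neg hk, if_neg hk, Finset.sum_Ico_succ_top (Nat.zero_le l)]
  ring

theorem branchMean_succ_of_le {l : ℕ} (hl : l₂ ≤ l) :
    branchMean L k₂ l₂ ν k₂ (l + 1) - branchMean L k₂ l₂ ν k₂ l =
      descentTime ν (L k₂) (L k₂ - (l + 1)) := by
  rw [branchMean, branchMean, if_pos rfl, if_pos rfl, Finset.sum_Ico_succ_top hl,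
    Finset.Ico_eq_empty (show ¬ l < l₂ by lia), Finset.Ico_eq_empty (show ¬ l + 1 < l₂ by lia)]
  simp

theorem branchMean_sub_succ_of_lt {l : ℕ} (hl : l < l₂) :
    branchMean L k₂ l₂ ν k₂ l - branchMean L k₂ l₂ ν k₂ (l + 1) =
      ascentTime ν (L k₂) (excursionWeight L k₂ ν) l := by
  rw [branchMean, branchMean, if_pos rfl, if_pos rfl, Finset.sum_eq_sum_Ico_succ_bot hl,
    Finset.Ico_eq_empty (show ¬ l₂ < l by lia), Finset.Ico_eq_empty (show ¬ l₂ < l + 1 by lia)]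
  simp

/-- In terms of the increments of `h`, the equation at each level is exactly the ascent or descent
recursion. At the centre it is the definition of `excursionWeight`. -/
theorem generator_mulVec_meanPassage (hν : 0 < ν) (hl₂ : 0 < l₂ ∧ l₂ ≤ L k₂) (x : StarState L)
    (hx : x ≠ StarState.mk k₂ l₂ hl₂) :
    (generator (starRate L ν)).mulVec
      (starFun L (centreMean L k₂ l₂ ν) (branchMean L k₂ l₂ ν)) x = -1 := by
  rcases x with _ | ⟨k, l, hl⟩
  · rw [generator_starRate_mulVec_none, ← Finset.sum_erase_add _ _ (Finset.mem_univ k₂)]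
    have h1 := branchMean_sub_succ_of_lt (L := L) (k₂ := k₂) (ν := ν) hl₂.1
    rw [zero_add, branchMean_zero] at h1
    have h2 := mul_ascentTime_zero hν (hl₂.1.trans_le hl₂.2) (excursionWeight L k₂ ν)
    rw [← h1] at h2
    have h3 : ∀ k ∈ Finset.univ.erase k₂,
        (L k : ℝ) * ν * (branchMean L k₂ l₂ ν k 1 - centreMean L k₂ l₂ ν) =
          (L k : ℝ) * ν * descentTime ν (L k) (L k - 1) := by
      intro k hk
      have := branchMean_succ_of_ne (L := L) (l₂ := l₂) (ν := ν) (Finset.ne_of_mem_erase hk) 0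
      rw [zero_add, branchMean_zero] at this
      rw [this]
    rw [Finset.sum_congr rfl h3]
    have h4 : excursionWeight L k₂ ν = 1 + _ := rfl
    linarith
  · rw [generator_starRate_mulVec_some L ν k (branchMean_zero k)]
    dsimp only
    obtain ⟨hl1, hlL⟩ := Finset.mem_Icc.1 hl
    obtain ⟨m, rfl⟩ : ∃ m, l = m + 1 := ⟨l - 1, by lia⟩
    rw [Nat.add_sub_cancel]
    by_cases hk : k = k₂
    · subst hk
      -- In the target branch, levels below `l₂` use the ascent recursion and levels above it the
      -- descent recursion.
      rcases lt_trichotomy (m + 1) l₂ with hlt | heq | hgt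
      · have h1 := branchMean_sub_succ_of_lt (L := L) (k₂ := k) (ν := ν) hlt
        have h2 := branchMean_sub_succ_of_lt (L := L) (k₂ := k) (ν := ν) (Nat.lt_of_succ_lt hlt)
        have h3 := mul_ascentTime_succ hν (hlt.trans_le hl₂.2) (excursionWeight L k ν)
        rw [h2, ← neg_sub (branchMean L k l₂ ν k (m + 1)), h1]
        push_cast
        linarith
      · exact absurd (by subst heq; rfl) hx
      · have h1 := branchMean_succ_of_le (L := L) (k₂ := k) (ν := ν) hgt.le
        have h2 := branchMean_succ_of_le (L := L) (k₂ := k) (ν := ν) (Nat.le_of_lt_succ hgt)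
        have h3 := mul_descentTime ν hl1 hlL
        rw [h1, ← neg_sub (branchMean L k l₂ ν k (m + 1)), h2]
        linarith
    · have h1 := branchMean_succ_of_ne (L := L) (l₂ := l₂) (ν := ν) hk (m + 1)
      have h2 := branchMean_succ_of_ne (L := L) (l₂ := l₂) (ν := ν) hk m
      have h3 := mul_descentTime ν hl1 hlL
      rw [h1, ← neg_sub (branchMean L k₂ l₂ ν k (m + 1)), h2]
      linarith

theorem lintegral_passageTime_star {k₁ : Fin K} {l₁ : ℕ} (hk : k₁ ≠ k₂)
    (hl₁ : 0 < l₁ ∧ l₁ ≤ L k₁) (hl₂ : 0 < l₂ ∧ l₂ ≤ L k₂) (hν : 0 < ν)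
    {Ω : Type*} [MeasurableSpace Ω] {P : Measure Ω} {X : ℝ≥0 → Ω → StarState L}
    (hX : IsMarkovProcess (starRate L ν) (StarState.mk k₁ l₁ hl₁) P X) :
    ∫⁻ ω, passageTime X (StarState.mk k₂ l₂ hl₂) ω ∂P =
      ENNReal.ofReal (branchMean L k₂ l₂ ν k₁ l₁) := by
  refine hX.lintegral_passageTime
    (h := starFun L (centreMean L k₂ l₂ ν) (branchMean L k₂ l₂ ν)) ?_ ?_ ?_
    fun x hx => generator_mulVec_meanPassage hν hl₂ x hx
  · intro h
    have := congrArg Sigma.fst (Option.some.inj h)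
    exact hk this
  · rintro (_ | ⟨k, l⟩)
    · exact centreMean_nonneg hν hl₂.2
    · exact branchMean_nonneg hν hl₂.2 k l
  · change branchMean L k₂ l₂ ν k₂ l₂ = 0
    simp [branchMean]

end MeanPassage

/-! ### Growth of the crossing times as `ν → ∞` -/

section Asymptotics

/-- The summand `1` in the recursion is negligible, so the limits satisfy `c (n + 1) = (n + 1) * c n
/ (L - (n + 1))`, which the binomial identity `hc` solves. -/
theorem tendsto_descentTime_div_pow (L : ℕ) : ∀ n, n < L →
    Tendsto (fun ν : ℝ => descentTime ν L n / ν ^ n) atTop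
      (𝓝 (1 / (((L : ℝ) - n) * L.choose n)))
  | 0, _ => by simp [descentTime]
  | n + 1, hn => by
    have ih := tendsto_descentTime_div_pow L n (by lia)
    have hn' : ((n + 1 : ℕ) : ℝ) < L := by exact_mod_cast hn
    push_cast at hn'
    have h0 : Tendsto (fun ν : ℝ => (ν ^ (n + 1))⁻¹) atTop (𝓝 0) :=
      (tendsto_pow_atTop n.succ_ne_zero).inv_tendsto_atTop
    have h1 := (h0.add (ih.const_mul ((n : ℝ) + 1))).div_const ((L : ℝ) - (n + 1))
    have hc : ((L.choose (n + 1) : ℕ) : ℝ) * (n + 1) = L.choose n * ((L : ℝ) - n) := by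
      have := Nat.choose_succ_right_eq L n
      rw [← Nat.cast_sub (by lia)]
      exact_mod_cast this
    have hpos : (0 : ℝ) < L.choose (n + 1) := by exact_mod_cast Nat.choose_pos hn.le
    have hpos' : (0 : ℝ) < L.choose n := by exact_mod_cast Nat.choose_pos (by lia)
    convert h1.congr' ?_ using 2
    · have e1 : (L : ℝ) - n ≠ 0 := by linarith
      have e2 : (L : ℝ) - (n + 1) ≠ 0 := by linarith
      push_cast
      rw [zero_add]
      field_simp
      linarith
    · filter_upwards [eventually_gt_atTop 0] with ν hν
      rw [descentTime, pow_succ]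
      field_simp

/-- The exponent `L - l` reaches `M - 1` only for the last descent in a component of maximal size.
-/
theorem tendsto_descentTime_div_pow_max {L M l : ℕ} (hl : 0 < l) (hlL : l ≤ L) (hLM : L ≤ M) :
    Tendsto (fun ν : ℝ => descentTime ν L (L - l) / ν ^ (M - 1)) atTop
      (𝓝 (if l = 1 ∧ L = M then 1 / (M : ℝ) else 0)) := by
  have h := tendsto_descentTime_div_pow L (L - l) (by lia)
  split_ifs with hc
  · obtain ⟨rfl, rfl⟩ := hc
    convert h using 2
    rw [Nat.choose_symm hlL, Nat.cast_sub hlL]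
    simp
  · have h0 : Tendsto (fun ν : ℝ => (ν ^ (M - 1 - (L - l)))⁻¹) atTop (𝓝 0) :=
      (tendsto_pow_atTop (by lia)).inv_tendsto_atTop
    have h1 := h.mul h0
    rw [mul_zero] at h1
    refine h1.congr fun ν => ?_
    rw [div_mul_eq_mul_div, mul_comm, mul_comm, ← div_eq_mul_inv, div_div, ← pow_add]
    congr 2
    lia

variable {K : ℕ} {L : Fin K → ℕ} {k₂ : Fin K}

theorem le_maxOtherSize {k : Fin K} (hk : k ≠ k₂) : L k ≤ maxOtherSize L k₂ :=
  Finset.le_sup (f := L) (Finset.mem_erase.2 ⟨hk, Finset.mem_univ k⟩)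

theorem maxOtherSet_nonempty {k : Fin K} (hk : k ≠ k₂) : (maxOtherSet L k₂).Nonempty := by
  obtain ⟨j, hj, hj'⟩ := Finset.exists_mem_eq_sup (Finset.univ.erase k₂)
    ⟨k, Finset.mem_erase.2 ⟨hk, Finset.mem_univ k⟩⟩ L
  exact ⟨j, by simp [maxOtherSet, maxOtherSize, hj', Finset.ne_of_mem_erase hj]⟩

/-- After division by `ν ^ M`, each term of `excursionWeight` tends to `1` if `L k = M` and to `0`
otherwise, so the sum counts `K_*`. -/
theorem tendsto_ascentTime_zero (hM : 0 < maxOtherSize L k₂) :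
    Tendsto (fun ν : ℝ => ascentTime ν (L k₂) (excursionWeight L k₂ ν) 0 /
      ν ^ (maxOtherSize L k₂ - 1)) atTop (𝓝 ((maxOtherSet L k₂).card / (L k₂ : ℝ))) := by
  set M := maxOtherSize L k₂ with hMdef
  have h0 : Tendsto (fun ν : ℝ => (ν ^ M)⁻¹) atTop (𝓝 0) :=
    (tendsto_pow_atTop hM.ne').inv_tendsto_atTop
  have h1 : ∀ k ∈ Finset.univ.erase k₂, Tendsto
      (fun ν : ℝ => (L k : ℝ) * (descentTime ν (L k) (L k - 1) / ν ^ (M - 1))) atTop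
      (𝓝 (if L k = M then 1 else 0)) := by
    intro k hk
    rcases Nat.eq_zero_or_pos (L k) with hL | hL
    · simp [hL, hM.ne]
    · have := (tendsto_descentTime_div_pow_max one_pos hL
        (le_maxOtherSize (L := L) (Finset.ne_of_mem_erase hk))).const_mul (L k : ℝ)
      convert this using 2
      split_ifs with e1 e2 e2 <;> simp_all
      field_simp
  have h2 := (h0.add (tendsto_finsetSum _ h1)).div_const (L k₂ : ℝ)
  convert h2.congr' ?_ using 2
  · rw [zero_add, Finset.sum_boole]
    congr 3
    ext k
    simp [maxOtherSet, hMdef]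
  · filter_upwards [eventually_gt_atTop 0] with ν hν
    rw [ascentTime, excursionWeight]
    obtain ⟨m, hm⟩ : ∃ m, M = m + 1 := ⟨M - 1, by lia⟩
    rw [hm, Nat.add_sub_cancel, div_div, mul_comm (L k₂ : ℝ), mul_assoc, mul_comm (L k₂ : ℝ),
      ← mul_assoc, ← div_div, ← pow_succ', add_div 1, Finset.sum_div, one_div]
    congr 2
    refine Finset.sum_congr rfl fun k _ => ?_
    rw [pow_succ]
    field_simp

/-- Each further ascent gains a factor `1 / ν` over the preceding one in the recursion. -/
theorem tendsto_ascentTime_succ (hM : 0 < maxOtherSize L k₂) (l : ℕ) :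
    Tendsto (fun ν : ℝ => ascentTime ν (L k₂) (excursionWeight L k₂ ν) (l + 1) /
      ν ^ (maxOtherSize L k₂ - 1)) atTop (𝓝 0) := by
  have hinv : Tendsto (fun ν : ℝ => ν⁻¹) atTop (𝓝 0) := tendsto_inv_atTop_zero
  -- The limit is `1` when `L_* = 1` and `0` otherwise; only its existence matters, as a factor
  -- `ν⁻¹` follows.
  have hpow : ∃ c : ℝ, Tendsto (fun ν : ℝ => (ν ^ (maxOtherSize L k₂ - 1))⁻¹) atTop (𝓝 c) := by
    rcases Nat.eq_zero_or_pos (maxOtherSize L k₂ - 1) with h | h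
    · exact ⟨1, by simp [h]⟩
    · exact ⟨0, (tendsto_pow_atTop h.ne').inv_tendsto_atTop⟩
  obtain ⟨c, hc⟩ := hpow
  have step : ∀ l (b : ℝ), Tendsto (fun ν : ℝ =>
      ascentTime ν (L k₂) (excursionWeight L k₂ ν) l / ν ^ (maxOtherSize L k₂ - 1)) atTop (𝓝 b) →
      Tendsto (fun ν : ℝ => ascentTime ν (L k₂) (excursionWeight L k₂ ν) (l + 1) /
        ν ^ (maxOtherSize L k₂ - 1)) atTop (𝓝 0) := by
    intro l b hb
    have := ((hc.add (hb.const_mul ((l : ℝ) + 1))).div_const ((L k₂ : ℝ) - (l + 1))).mul hinv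
    rw [mul_zero] at this
    refine this.congr fun ν => ?_
    rw [ascentTime, ← div_div, div_right_comm _ ν, div_right_comm _ ((L k₂ : ℝ) - (l + 1)),
      add_div 1, one_div, mul_div_assoc, ← div_eq_mul_inv]
  induction l with
  | zero => exact step 0 _ (tendsto_ascentTime_zero hM)
  | succ l ih => exact step (l + 1) _ ih

theorem tendsto_branchMean {k₁ : Fin K} {l₁ l₂ : ℕ} (hk : k₁ ≠ k₂) (hl₁ : 0 < l₁ ∧ l₁ ≤ L k₁)
    (hl₂ : 0 < l₂) :
    Tendsto (fun ν : ℝ => branchMean L k₂ l₂ ν k₁ l₁ / ν ^ (maxOtherSize L k₂ - 1)) atTop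
      (𝓝 ((if k₁ ∈ maxOtherSet L k₂ then 1 else 0) / (maxOtherSize L k₂ : ℝ) +
        ((maxOtherSet L k₂).card : ℝ) / (L k₂ : ℝ))) := by
  have hle := le_maxOtherSize (L := L) hk
  have hM : 0 < maxOtherSize L k₂ := by lia
  simp only [branchMean, if_neg hk, centreMean, add_div, Finset.sum_div]
  rw [add_comm]
  refine Tendsto.add ?_ ?_
  · obtain ⟨m, rfl⟩ : ∃ m, l₂ = m + 1 := ⟨l₂ - 1, by lia⟩
    simp only [Finset.sum_eq_sum_Ico_succ_bot hl₂]
    rw [← add_zero ((maxOtherSet L k₂).card / (L k₂ : ℝ))]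
    refine (tendsto_ascentTime_zero hM).add ?_
    have hzero : ∀ j ∈ Finset.Ico (0 + 1) (m + 1), Tendsto (fun ν : ℝ =>
        ascentTime ν (L k₂) (excursionWeight L k₂ ν) j / ν ^ (maxOtherSize L k₂ - 1)) atTop
        (𝓝 0) := by
      intro j hj
      obtain ⟨i, rfl⟩ : ∃ i, j = i + 1 := ⟨j - 1, by have := Finset.mem_Ico.1 hj; lia⟩
      exact tendsto_ascentTime_succ hM i
    simpa using tendsto_finsetSum _ hzero
  · have hterm : ∀ j ∈ Finset.Ico 0 l₁, Tendsto (fun ν : ℝ =>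
        descentTime ν (L k₁) (L k₁ - (j + 1)) / ν ^ (maxOtherSize L k₂ - 1)) atTop
        (𝓝 (if j + 1 = 1 ∧ L k₁ = maxOtherSize L k₂ then 1 / (maxOtherSize L k₂ : ℝ) else 0)) :=
      fun j hj => tendsto_descentTime_div_pow_max j.succ_pos
        (by have := Finset.mem_Ico.1 hj; lia) hle
    have := tendsto_finsetSum _ hterm
    convert this using 2
    rw [Finset.sum_eq_single_of_mem 0 (Finset.mem_Ico.2 ⟨le_rfl, hl₁.1⟩)
      fun j _ hj => if_neg (by lia)]
    simp [maxOtherSet, hk, ite_div]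

end Asymptotics

end

theorem theorem3 {K : ℕ} (L : Fin K → ℕ) (k₁ k₂ : Fin K) (hk : k₁ ≠ k₂) (l₁ l₂ : ℕ)
    (hl₁ : 0 < l₁ ∧ l₁ ≤ L k₁) (hl₂ : 0 < l₂ ∧ l₂ ≤ L k₂)
    {Ω : ℝ → Type*} [∀ ν, MeasurableSpace (Ω ν)] (P : ∀ ν, Measure (Ω ν))
    (X : ∀ ν, ℝ≥0 → Ω ν → StarState L)
    (hX : ∀ ν, 0 < ν →
      IsMarkovProcess (starRate L ν) (StarState.mk k₁ l₁ hl₁) (P ν) (X ν)) :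
    (∀ ν, 0 < ν → ∫⁻ ω, passageTime (X ν) (StarState.mk k₂ l₂ hl₂) ω ∂(P ν) ≠ ∞) ∧
    Tendsto
      (fun ν : ℝ =>
        (∫⁻ ω, passageTime (X ν) (StarState.mk k₂ l₂ hl₂) ω ∂(P ν)).toReal /
          (((if k₁ ∈ maxOtherSet L k₂ then 1 else 0) / (maxOtherSize L k₂ : ℝ) +
              ((maxOtherSet L k₂).card : ℝ) / (L k₂ : ℝ)) *
            ν ^ (maxOtherSize L k₂ - 1)))
      atTop (𝓝 1) := by
  have hmean := fun ν (hν : 0 < ν) => lintegral_passageTime_star hk hl₁ hl₂ hν (hX ν hν)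
  refine ⟨fun ν hν => by rw [hmean ν hν]; exact ENNReal.ofReal_ne_top, ?_⟩
  set C : ℝ := (if k₁ ∈ maxOtherSet L k₂ then 1 else 0) / (maxOtherSize L k₂ : ℝ) +
    ((maxOtherSet L k₂).card : ℝ) / (L k₂ : ℝ) with hC
  -- Some component attains the maximum `L_*`, so `K_*` is nonempty and the division by `C` is
  -- legitimate.
  have hCpos : 0 < C := by
    have h1 : (0 : ℝ) < (maxOtherSet L k₂).card := by
      exact_mod_cast (maxOtherSet_nonempty hk).card_pos
    have h2 : (0 : ℝ) < L k₂ := by exact_mod_cast hl₂.1.trans_le hl₂.2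
    refine add_pos_of_nonneg_of_pos ?_ (div_pos h1 h2)
    split_ifs <;> positivity
  have hlim := (tendsto_branchMean (L := L) hk hl₁ hl₂.1).div_const C
  rw [← hC, div_self hCpos.ne'] at hlim
  refine hlim.congr' ?_
  filter_upwards [eventually_gt_atTop 0] with ν hν
  rw [hmean ν hν, ENNReal.toReal_ofReal (branchMean_nonneg hν hl₂.2 _ _), div_div, mul_comm C]
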